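/- A random geometric graph on $\mathbb{R}$ is a random graph $G=(V,E)$ whose vertex set $V$ is a countable random subset of $\mathbb{R}$ and whose edge set $E$ is a random set of unordered pairs of distinct elements of $V$. A connected component (cluster) of $G$ is called recurrent if all its vertices have finite degree and, for each of its vertices $x$, simple random walk on $G$ started at $x$ almost surely returns to $x$ (a cluster consisting of a single isolated vertex counts as recurrent); otherwise it is transient. **Lemma.** Let $G=(V,E)$ be a random geometric graph on $\mathbb{R}$ whose vertex set is almost surely locally finite, i.e. almost surely $V\cap[a,b]$ is finite for all real $a\le b$. Suppose that, for some non-trivial subgroup $H\neq\{0\}$ of $(\mathbb{R},+)$, the distribution of $G$ is invariant and ergodic under the translations by elements of $H$. Let $$\mathsf{X}=\sum_{x\in V:\,x\le 0}\ \sum_{y\in V:\,y>0}\mathbf{1}\{xy\in E\}$$ be the number of edges of $G$ crossing over $0+$. If $\mathbb{P}(\mathsf{X}<\infty)>0$, then almost surely all clusters of $G$ are recurrent. -/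

import Mathlib

open MeasureTheory ProbabilityTheory

/-! ### Simple random walk on a countable graph -/

section Walk

variable {W : Type*} [MeasurableSpace W] [DiscreteMeasurableSpace W]

/-- The law of one step of simple random walk from `x`: uniform on the neighbours of `x` if there
are finitely many and at least one of them; otherwise the walk stays put (this convention matters
only for isolated vertices, clusters with a vertex of infinite degree being transient below). -/
noncomputable def SimpleGraph.stepLaw {W : Type*} (G : SimpleGraph W) (x : W) : PMF W :=
  open Classical in
  if h : (G.neighborSet x).Finite ∧ (G.neighborSet x).Nonempty then
    PMF.uniformOfFinset h.1.toFinset (h.1.toFinset_nonempty.2 h.2)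
  else PMF.pure x

/-- The transition kernel of simple random walk. -/
noncomputable def SimpleGraph.stepKernel (G : SimpleGraph W) : Kernel W W where
  toFun x := (G.stepLaw x).toMeasure
  measurable' := Measurable.of_discrete

instance SimpleGraph.isMarkovKernel_stepKernel (G : SimpleGraph W) :
    IsMarkovKernel G.stepKernel :=
  ⟨fun x => PMF.toMeasure.isProbabilityMeasure (G.stepLaw x)⟩

/-- The Markovian transition at time `n`, as a kernel depending on the trajectory up to time `n`
only through its last position. -/
noncomputable def SimpleGraph.historyKernel (G : SimpleGraph W) (n : ℕ) :
    Kernel ((_ : Finset.Iic n) → W) W :=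
  G.stepKernel.comap (fun p => p ⟨n, Finset.mem_Iic.2 le_rfl⟩) (measurable_pi_apply _)

instance SimpleGraph.isMarkovKernel_historyKernel (G : SimpleGraph W) (n : ℕ) :
    IsMarkovKernel (G.historyKernel n) := by
  unfold SimpleGraph.historyKernel; infer_instance

/-- The law, on the space of trajectories, of simple random walk on `G` started at `x`. -/
noncomputable def SimpleGraph.walkLaw (G : SimpleGraph W) (x : W) : Measure (ℕ → W) :=
  Kernel.traj (X := fun _ => W) G.historyKernel 0 (fun _ => x)

/-- The cluster of `x` is recurrent: it is locally finite, and simple random walk started at `x`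
almost surely returns to `x`. -/
def SimpleGraph.ClusterRecurrent (G : SimpleGraph W) (x : W) : Prop :=
  (∀ y, G.Reachable x y → (G.neighborSet y).Finite) ∧
    ∀ᵐ X ∂(G.walkLaw x), ∃ n : ℕ, 1 ≤ n ∧ X n = x

end Walk

/-! ### Geometric graphs on the line -/

/-- A graph with a countable vertex set `verts ⊆ ℝ`. The edges are those of `graph`, a simple graph
on `ℝ` all of whose edges have their endpoints in `verts`. -/
structure GeometricGraph where
  verts : Set ℝ
  countable_verts : verts.Countable
  graph : SimpleGraph ℝ
  mem_of_adj : ∀ x y, graph.Adj x y → x ∈ verts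

namespace GeometricGraph

instance (g : GeometricGraph) : Countable g.verts := g.countable_verts.to_subtype

/-- The edges of `g`, as ordered pairs of adjacent points: each edge appears in both orientations. -/
def arcs (g : GeometricGraph) : Set (ℝ × ℝ) := {p | g.graph.Adj p.1 p.2}

/-- The σ-algebra generated by the numbers of vertices in Borel subsets of `ℝ` and the numbers
of oriented edges in Borel subsets of `ℝ × ℝ`. -/
noncomputable instance : MeasurableSpace GeometricGraph :=
  (⨆ (A : Set ℝ) (_ : MeasurableSet A),
      MeasurableSpace.comap (fun g : GeometricGraph => (g.verts ∩ A).encard) ⊤) ⊔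
    (⨆ (B : Set (ℝ × ℝ)) (_ : MeasurableSet B),
      MeasurableSpace.comap (fun g : GeometricGraph => (g.arcs ∩ B).encard) ⊤)

/-- The graph moved by `h`: it has the vertices `x + h` and edges between `x + h` and `y + h`,
for vertices `x` and edges `xy` of `g`. -/
def translate (h : ℝ) (g : GeometricGraph) : GeometricGraph where
  verts := {x | x - h ∈ g.verts}
  countable_verts := g.countable_verts.preimage (sub_left_injective (b := h))
  graph := g.graph.comap (fun x => x - h)
  mem_of_adj x y hxy := g.mem_of_adj (x - h) (y - h) hxy

/-- The vertex set has finitely many points in every bounded interval. -/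
def LocallyFiniteVerts (g : GeometricGraph) : Prop :=
  ∀ a b : ℝ, (g.verts ∩ Set.Icc a b).Finite

/-- The number of edges above `0+`: edges `xy` with `x ≤ 0 < y`. -/
noncomputable def crossings (g : GeometricGraph) : ℕ∞ :=
  {p : ℝ × ℝ | p.1 ≤ 0 ∧ 0 < p.2 ∧ g.graph.Adj p.1 p.2}.encard

/-- All clusters of `g` are recurrent; the walk lives on the vertex set of `g`. -/
def AllClustersRecurrent (g : GeometricGraph) : Prop :=
  ∀ x : g.verts, (g.graph.induce g.verts).ClusterRecurrent x

/-- The law `ν` of a random geometric graph is invariant under the translations in `H`. -/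
def TranslationInvariant (H : AddSubgroup ℝ) (ν : Measure GeometricGraph) : Prop :=
  ∀ h ∈ H, MeasurePreserving (translate h) ν ν

/-- The probability law `ν` is ergodic under the translations in `H`: every event that is
invariant under all of them has probability `0` or `1`. -/
def TranslationErgodic (H : AddSubgroup ℝ) (ν : Measure GeometricGraph) : Prop :=
  ∀ A : Set GeometricGraph, MeasurableSet A → (∀ h ∈ H, translate h ⁻¹' A = A) →
    ν A = 0 ∨ ν A = 1

end GeometricGraph

/-!
Suppose that every finite set of vertices of a graph `Γ` lies in a finite set `B` which at most
`C` edges leave. Let `f x` be the probability that simple random walk started at `x` never visits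
`o`. This is a bounded function, harmonic off `o` and subharmonic at `o`. Green's formula on the
sets `B` bounds the Dirichlet energy of `f`, so all but finitely many edges have a small increment
of `f`. For large `B` the flux of the gradient of `f` out of `B`, a sum of at most `C` increments,
is therefore small; but it is at least the Laplacian of `f` at `o`, which must vanish. That
Laplacian is the degree of `o` times the probability that the walk never returns to `o`.

For a random geometric graph, ergodicity almost surely yields a point with finitely many edges, say
`M`, above it. Poincaré recurrence under the translations by `h` and by `-h` provides points with at
most `M` edges above them arbitrarily far to the right and to the left, and the vertices between two
of these points form a set `B` as above, with `C = M + M`.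
-/

open Filter Topology
open scoped ENNReal

/-! ### Simple random walk avoiding a vertex -/

section KilledWalk

lemma lintegral_uniformOfFinset {α : Type*} [MeasurableSpace α] [MeasurableSingletonClass α]
    (s : Finset α) (hs : s.Nonempty) (f : α → ℝ≥0∞) :
    ∫⁻ z, f z ∂(PMF.uniformOfFinset s hs).toMeasure = (s.card : ℝ≥0∞)⁻¹ * ∑ z ∈ s, f z := by
  classical
  have hsum : (PMF.uniformOfFinset s hs).toMeasure =
      (s.card : ℝ≥0∞)⁻¹ • ∑ z ∈ s, Measure.dirac z := by
    ext t ht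
    rw [PMF.toMeasure_uniformOfFinset_apply _ _ ht, Measure.smul_apply, Measure.finsetSum_apply,
      smul_eq_mul, ENNReal.div_eq_inv_mul]
    simp only [Measure.dirac_apply, Set.indicator_apply, Pi.one_apply, Finset.sum_boole]
  simp only [hsum, lintegral_smul_measure, lintegral_finsetSum_measure, lintegral_dirac,
    smul_eq_mul]

variable {W : Type*} [MeasurableSpace W] [DiscreteMeasurableSpace W] (Γ : SimpleGraph W)

lemma stepKernel_eq_dirac {x : W} (hx : ¬ (Γ.neighborSet x).Nonempty) :
    Γ.stepKernel x = Measure.dirac x := by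
  change (Γ.stepLaw x).toMeasure = _
  rw [SimpleGraph.stepLaw, dif_neg fun h => hx h.2, PMF.toMeasure_pure]

lemma degree_mul_lintegral_stepKernel [Γ.LocallyFinite] (x : W) (f : W → ℝ≥0∞) :
    (Γ.degree x : ℝ≥0∞) * ∫⁻ z, f z ∂(Γ.stepKernel x) = ∑ z ∈ Γ.neighborFinset x, f z := by
  have hfin : (Γ.neighborSet x).Finite := Set.toFinite _
  have htoFinset : hfin.toFinset = Γ.neighborFinset x := by ext; simp
  rcases (Γ.neighborSet x).eq_empty_or_nonempty with hempty | hne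
  · have hnbr : Γ.neighborFinset x = ∅ := by rw [← htoFinset, hfin.toFinset_eq_empty, hempty]
    simp [← SimpleGraph.card_neighborFinset_eq_degree, hnbr]
  · have hdeg : (Γ.degree x : ℝ≥0∞) ≠ 0 :=
      Nat.cast_ne_zero.2 ((Γ.degree_pos_iff_exists_adj x).2 hne).ne'
    change _ * ∫⁻ z, f z ∂(Γ.stepLaw x).toMeasure = _
    rw [SimpleGraph.stepLaw, dif_pos ⟨hfin, hne⟩, lintegral_uniformOfFinset, htoFinset,
      SimpleGraph.card_neighborFinset_eq_degree, ← mul_assoc,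
      ENNReal.mul_inv_cancel hdeg (ENNReal.natCast_ne_top _), one_mul]

lemma lintegral_walkLaw_zero (x : W) (f : W → ℝ≥0∞) :
    ∫⁻ X, f (X 0) ∂(Γ.walkLaw x) = f x := by
  have hf : Measurable f := Measurable.of_discrete
  have hstart := Kernel.traj_map_frestrictLe_apply (X := fun _ => W) (κ := Γ.historyKernel) 0 0
    (fun _ => x)
  rw [Kernel.partialTraj_self, Kernel.id_apply] at hstart
  have hint := congrArg (fun μ => ∫⁻ p, f (p ⟨0, Finset.mem_Iic.2 le_rfl⟩) ∂μ) hstart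
  rwa [lintegral_map (by fun_prop) (by fun_prop), lintegral_dirac' _ (by fun_prop)] at hint

lemma lintegral_walkLaw_succ (x : W) (n : ℕ) {F : ((_ : Finset.Iic n) → W) → ℝ≥0∞}
    (hF : Measurable F) (f : W → ℝ≥0∞) :
    ∫⁻ X, F (Preorder.frestrictLe n X) * f (X (n + 1)) ∂(Γ.walkLaw x) =
      ∫⁻ X, F (Preorder.frestrictLe n X) * ∫⁻ z, f z ∂(Γ.stepKernel (X n)) ∂(Γ.walkLaw x) := by
  have hf : Measurable f := Measurable.of_discrete
  have hnext := Kernel.partialTraj_compProd_eq_map_traj (X := fun _ => W) (κ := Γ.historyKernel)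
    (Nat.zero_le n) (x₀ := fun _ => x)
  rw [← Kernel.traj_map_frestrictLe_apply] at hnext
  have hint := congrArg (fun μ => ∫⁻ p, (F p.1 * f p.2 : ℝ≥0∞) ∂μ) hnext
  rw [lintegral_map (by fun_prop) (by fun_prop), Measure.lintegral_compProd (by fun_prop)] at hint
  simp only [lintegral_const_mul _ hf] at hint
  have hstep : Measurable fun p => F p * ∫⁻ z, f z ∂(Γ.historyKernel n p) :=
    hF.mul hf.lintegral_kernel
  rw [lintegral_map hstep (by fun_prop)] at hint
  exact hint.symm

/-- The transition operator of simple random walk killed on entering `o`. -/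
noncomputable def killedStep (o : W) (f : W → ℝ≥0∞) (x : W) : ℝ≥0∞ :=
  ∫⁻ z, ({o}ᶜ : Set W).indicator f z ∂(Γ.stepKernel x)

lemma monotone_killedStep (o : W) : Monotone (killedStep Γ o) := fun _ _ h _ =>
  lintegral_mono fun z => Set.indicator_le_indicator (h z)

lemma killedStep_one_le (o : W) : killedStep Γ o 1 ≤ 1 := fun x =>
  calc killedStep Γ o 1 x ≤ ∫⁻ _, 1 ∂(Γ.stepKernel x) :=
        lintegral_mono fun z => Set.indicator_le_self _ _ z
    _ = 1 := by rw [lintegral_one, measure_univ]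

lemma antitone_iterate_killedStep_one (o : W) : Antitone fun n => (killedStep Γ o)^[n] 1 :=
  (monotone_killedStep Γ o).antitone_iterate_of_map_le (killedStep_one_le Γ o)

lemma killedStep_iInf (o : W) {f : ℕ → W → ℝ≥0∞} (hf : Antitone f) (hf0 : f 0 ≤ 1) (x : W) :
    killedStep Γ o (⨅ n, f n) x = ⨅ n, killedStep Γ o (f n) x := by
  have hind : ∀ z, ({o}ᶜ : Set W).indicator (⨅ n, f n) z =
      ⨅ n, ({o}ᶜ : Set W).indicator (f n) z := fun z => by
    by_cases hz : z ∈ ({o}ᶜ : Set W) <;> simp [hz]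
  have hfinite : killedStep Γ o (f 0) x ≠ ∞ :=
    ((monotone_killedStep Γ o hf0 x).trans (killedStep_one_le Γ o x)).trans_lt
      ENNReal.one_lt_top |>.ne
  simp only [killedStep, hind]
  exact lintegral_iInf (fun _ => Measurable.of_discrete)
    (fun _ _ hmn z => Set.indicator_le_indicator (hf hmn z)) hfinite

lemma lintegral_walkLaw_prod_indicator (o x : W) (n : ℕ) (f : W → ℝ≥0∞) :
    ∫⁻ X, (∏ k : Fin n, ({o}ᶜ : Set W).indicator 1 (X (k + 1))) * f (X n) ∂(Γ.walkLaw x) =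
      (killedStep Γ o)^[n] f x := by
  induction n generalizing f with
  | zero => simpa using lintegral_walkLaw_zero Γ x f
  | succ n ih =>
    let F : ((_ : Finset.Iic n) → W) → ℝ≥0∞ := fun p =>
      ∏ k : Fin n, ({o}ᶜ : Set W).indicator 1 (p ⟨k + 1, Finset.mem_Iic.2 k.2⟩)
    have hF : Measurable F := Finset.measurable_prod _ fun k _ =>
      (Measurable.of_discrete (f := ({o}ᶜ : Set W).indicator 1)).comp (measurable_pi_apply _)
    have hlast : ∀ z, ({o}ᶜ : Set W).indicator 1 z * f z = ({o}ᶜ : Set W).indicator f z :=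
      fun z => by by_cases hz : z = o <;> simp [hz]
    rw [Function.iterate_succ_apply, ← ih]
    simp only [Fin.prod_univ_castSucc, mul_assoc, Fin.val_castSucc, Fin.val_last, hlast]
    exact lintegral_walkLaw_succ Γ x n hF _

/-- The probability that simple random walk started at `x` avoids `o` at all times `n ≥ 1`, as the
limit of the probabilities of avoiding `o` at times `1, …, n`. -/
noncomputable def avoidProb (o : W) : W → ℝ≥0∞ := ⨅ n, (killedStep Γ o)^[n] 1

lemma avoidProb_le_one (o x : W) : avoidProb Γ o x ≤ 1 :=
  iInf_le (fun n => (killedStep Γ o)^[n] 1) 0 x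

lemma killedStep_avoidProb (o : W) : killedStep Γ o (avoidProb Γ o) = avoidProb Γ o := by
  have hanti := antitone_iterate_killedStep_one Γ o
  funext x
  calc killedStep Γ o (avoidProb Γ o) x = ⨅ n, (killedStep Γ o)^[n + 1] 1 x := by
        simp only [avoidProb, killedStep_iInf Γ o hanti le_rfl, Function.iterate_succ_apply']
    _ = ⨅ n, (killedStep Γ o)^[n] 1 x :=
        Antitone.iInf_nat_add (f := fun n => (killedStep Γ o)^[n] 1 x)
          (fun _ _ hmn => hanti hmn x) 1
    _ = avoidProb Γ o x := (iInf_apply ..).symm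

lemma avoidProb_self_eq_zero_of_isolated {o : W} (ho : ¬ (Γ.neighborSet o).Nonempty) :
    avoidProb Γ o o = 0 := by
  rw [← killedStep_avoidProb, killedStep, stepKernel_eq_dirac Γ ho, lintegral_dirac]
  simp

lemma ae_walkLaw_return_of_avoidProb_eq_zero {o : W} (ho : avoidProb Γ o o = 0) :
    ∀ᵐ X ∂(Γ.walkLaw o), ∃ n : ℕ, 1 ≤ n ∧ X n = o := by
  rw [ae_iff, ← nonpos_iff_eq_zero, ← ho, avoidProb, iInf_apply]
  refine le_iInf fun n => ?_
  rw [← lintegral_walkLaw_prod_indicator]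
  refine meas_le_lintegral₀ (Measurable.aemeasurable ?_) fun X hX => ?_
  · exact (Finset.measurable_prod _ fun k _ =>
      (Measurable.of_discrete (f := ({o}ᶜ : Set W).indicator 1)).comp
        (measurable_pi_apply _)).mul measurable_const
  · have havoid : ∀ k : Fin n, X (k + 1) ≠ o := fun k hk => hX ⟨k + 1, Nat.le_add_left .., hk⟩
    simp [havoid]

end KilledWalk

/-! ### Bounded subharmonic functions and small cuts -/

section SmallCuts

variable {W : Type*} (Γ : SimpleGraph W)

/-- The oriented edges of `Γ` leading out of `B`. -/
def outArcs (B : Set W) : Set (W × W) := {p | p.1 ∈ B ∧ p.2 ∉ B ∧ Γ.Adj p.1 p.2}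

/-- Every finite set of vertices is contained in a finite set with at most `C` edges leaving it. -/
def HasSmallCuts (C : ℕ) : Prop :=
  ∀ F : Finset W, ∃ B : Finset W, F ⊆ B ∧ (outArcs Γ B).encard ≤ C

/-- The combinatorial graph Laplacian, with the sign for which it is nonnegative on subharmonic
functions. -/
def graphLaplacian [Γ.LocallyFinite] (f : W → ℝ) (x : W) : ℝ :=
  ∑ z ∈ Γ.neighborFinset x, (f z - f x)

variable {Γ}

lemma HasSmallCuts.finite_neighborSet {C : ℕ} (h : HasSmallCuts Γ C) (x : W) :
    (Γ.neighborSet x).Finite := by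
  obtain ⟨B, hxB, hBC⟩ := h {x}
  have hout : (outArcs Γ B).Finite :=
    Set.encard_lt_top_iff.1 (hBC.trans_lt (ENat.natCast_lt_top C))
  refine (B.finite_toSet.union (hout.image Prod.snd)).subset fun y hxy => ?_
  by_cases hyB : y ∈ B
  · exact Or.inl hyB
  · exact Or.inr ⟨(x, y), ⟨hxB (Finset.mem_singleton_self x), hyB, hxy⟩, rfl⟩

lemma sum_outArcs_le {C : ℕ} {B : Set W} (hB : (outArcs Γ B).Finite)
    (hBC : (outArcs Γ B).encard ≤ C) {a : W × W → ℝ} {r : ℝ} (hr : 0 ≤ r)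
    (ha : ∀ p ∈ outArcs Γ B, a p ≤ r) : ∑ p ∈ hB.toFinset, a p ≤ C * r := by
  rw [hB.encard_eq_coe_toFinset_card, Nat.cast_le] at hBC
  calc ∑ p ∈ hB.toFinset, a p ≤ hB.toFinset.card • r :=
        Finset.sum_le_card_nsmul _ _ _ fun p hp => ha p (hB.mem_toFinset.1 hp)
    _ ≤ C * r := by rw [nsmul_eq_mul]; gcongr

section Green

variable [DecidableRel Γ.Adj]

lemma sum_interedges_self_swap {M : Type*} [AddCommMonoid M] (B : Finset W) (a : W → W → M) :
    ∑ p ∈ Γ.interedges B B, a p.2 p.1 = ∑ p ∈ Γ.interedges B B, a p.1 p.2 :=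
  Finset.sum_equiv (Equiv.prodComm W W)
    (fun p => by simp [SimpleGraph.interedges, Rel.mem_interedges_iff, Γ.adj_comm, and_left_comm])
    fun _ _ => rfl

variable [Γ.LocallyFinite]

lemma sum_sum_neighborFinset {M : Type*} [AddCommMonoid M] (B : Finset W)
    (hB : (outArcs Γ B).Finite) (a : W → W → M) :
    ∑ x ∈ B, ∑ z ∈ Γ.neighborFinset x, a x z =
      ∑ p ∈ Γ.interedges B B, a p.1 p.2 + ∑ p ∈ hB.toFinset, a p.1 p.2 := by
  classical
  have hdisj : Disjoint (Γ.interedges B B) hB.toFinset :=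
    Finset.disjoint_left.2 fun p hin hout =>
      (hB.mem_toFinset.1 hout).2.1 (Rel.mem_interedges_iff.1 hin).2.1
  rw [← Finset.sum_union hdisj]
  refine (Finset.sum_finset_product' _ _ _ fun p => ?_).symm
  rw [Finset.mem_union, hB.mem_toFinset]
  simp only [SimpleGraph.interedges, Rel.mem_interedges_iff, outArcs, Set.mem_ofPred_eq,
    Finset.mem_coe, SimpleGraph.mem_neighborFinset]
  tauto

/-- Green's formula: the term over `Γ.interedges B B` is halved because that set contains each edge
inside `B` in both orientations. -/
lemma sum_mul_graphLaplacian (B : Finset W) (hB : (outArcs Γ B).Finite) (f g : W → ℝ) :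
    ∑ x ∈ B, g x * graphLaplacian Γ f x =
      ∑ p ∈ hB.toFinset, g p.1 * (f p.2 - f p.1) -
        (∑ p ∈ Γ.interedges B B, (g p.2 - g p.1) * (f p.2 - f p.1)) / 2 := by
  have hsplit := sum_sum_neighborFinset B hB fun x z => g x * (f z - f x)
  have hswap := sum_interedges_self_swap (Γ := Γ) B fun x z => g x * (f z - f x)
  have hinner : ∑ p ∈ Γ.interedges B B, (g p.2 - g p.1) * (f p.2 - f p.1) =
      -∑ p ∈ Γ.interedges B B, g p.2 * (f p.1 - f p.2) -
        ∑ p ∈ Γ.interedges B B, g p.1 * (f p.2 - f p.1) := by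
    rw [← Finset.sum_neg_distrib, ← Finset.sum_sub_distrib]
    exact Finset.sum_congr rfl fun p _ => by ring
  simp only [graphLaplacian, Finset.mul_sum]
  linarith

variable {C : ℕ} {f : W → ℝ} {M : ℝ}

lemma sum_interedges_sq_sub_le {B : Finset W} (hBC : (outArcs Γ B).encard ≤ C)
    (hf : ∀ x, f x ∈ Set.Icc 0 M) (hsub : ∀ x, 0 ≤ graphLaplacian Γ f x) :
    ∑ p ∈ Γ.interedges B B, (f p.2 - f p.1) ^ 2 ≤ 2 * (C * M ^ 2) := by
  have hB : (outArcs Γ B).Finite := Set.encard_lt_top_iff.1 (hBC.trans_lt (ENat.natCast_lt_top C))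
  have hgreen := sum_mul_graphLaplacian B hB f f
  have hnonneg : 0 ≤ ∑ x ∈ B, f x * graphLaplacian Γ f x :=
    Finset.sum_nonneg fun x _ => mul_nonneg (hf x).1 (hsub x)
  have hboundary : ∑ p ∈ hB.toFinset, f p.1 * (f p.2 - f p.1) ≤ C * M ^ 2 :=
    sum_outArcs_le hB hBC (sq_nonneg M) fun p _ => by
      obtain ⟨hx0, hxM⟩ := hf p.1
      calc f p.1 * (f p.2 - f p.1) ≤ f p.1 * f p.2 :=
            mul_le_mul_of_nonneg_left (sub_le_self _ hx0) hx0
        _ ≤ M * M := mul_le_mul hxM (hf p.2).2 (hf p.2).1 (hx0.trans hxM)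
        _ = M ^ 2 := (sq M).symm
  simp only [sq (_ - _)]
  linarith

lemma HasSmallCuts.summable_sq_sub (h : HasSmallCuts Γ C) (hf : ∀ x, f x ∈ Set.Icc 0 M)
    (hsub : ∀ x, 0 ≤ graphLaplacian Γ f x) :
    Summable fun p : W × W => if Γ.Adj p.1 p.2 then (f p.2 - f p.1) ^ 2 else 0 := by
  classical
  have hnonneg : ∀ p : W × W, 0 ≤ if Γ.Adj p.1 p.2 then (f p.2 - f p.1) ^ 2 else 0 :=
    fun p => by positivity
  refine summable_of_sum_le hnonneg (c := 2 * (C * M ^ 2)) fun T => ?_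
  obtain ⟨B, hTB, hBC⟩ := h (T.image Prod.fst ∪ T.image Prod.snd)
  have hT : T ⊆ B ×ˢ B := fun p hp => Finset.mem_product.2
    ⟨hTB (Finset.mem_union_left _ (Finset.mem_image_of_mem _ hp)),
      hTB (Finset.mem_union_right _ (Finset.mem_image_of_mem _ hp))⟩
  calc ∑ p ∈ T, (if Γ.Adj p.1 p.2 then (f p.2 - f p.1) ^ 2 else 0)
      ≤ ∑ p ∈ B ×ˢ B, if Γ.Adj p.1 p.2 then (f p.2 - f p.1) ^ 2 else 0 :=
        Finset.sum_le_sum_of_subset_of_nonneg hT fun p _ _ => hnonneg p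
    _ = ∑ p ∈ Γ.interedges B B, (f p.2 - f p.1) ^ 2 := (Finset.sum_filter ..).symm
    _ ≤ 2 * (C * M ^ 2) := sum_interedges_sq_sub_le hBC hf hsub

end Green

lemma sum_graphLaplacian [Γ.LocallyFinite] (B : Finset W) (hB : (outArcs Γ B).Finite)
    (f : W → ℝ) : ∑ x ∈ B, graphLaplacian Γ f x = ∑ p ∈ hB.toFinset, (f p.2 - f p.1) := by
  classical
  simpa using sum_mul_graphLaplacian B hB f 1

variable {C : ℕ}

lemma HasSmallCuts.graphLaplacian_eq_zero [Γ.LocallyFinite] (h : HasSmallCuts Γ C) {f : W → ℝ}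
    {M : ℝ} (hf : ∀ x, f x ∈ Set.Icc 0 M) (hsub : ∀ x, 0 ≤ graphLaplacian Γ f x) (o : W) :
    graphLaplacian Γ f o = 0 := by
  classical
  suffices hsmall : ∀ ε > 0, graphLaplacian Γ f o ≤ C * ε by
    have hlim : Tendsto (fun ε : ℝ => C * ε) (𝓝[>] 0) (𝓝 0) :=
      ((continuous_const_mul (C : ℝ)).tendsto' 0 0 (mul_zero _)).mono_left nhdsWithin_le_nhds
    exact le_antisymm (ge_of_tendsto hlim (eventually_mem_nhdsWithin.mono hsmall)) (hsub o)
  intro ε hε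
  have hsteep : {p : W × W | Γ.Adj p.1 p.2 ∧ ε < f p.2 - f p.1}.Finite := by
    refine ((h.summable_sq_sub hf hsub).tendsto_cofinite_zero.eventually_lt_const
      (pow_pos hε 2)).subset fun p ⟨hadj, hlt⟩ hp => ?_
    rw [Set.mem_ofPred_eq, if_pos hadj] at hp
    exact hp.not_gt (pow_lt_pow_left₀ hlt hε.le two_ne_zero)
  obtain ⟨B, hFB, hBC⟩ := h (insert o (hsteep.toFinset.image Prod.snd))
  have hB : (outArcs Γ B).Finite := Set.encard_lt_top_iff.1 (hBC.trans_lt (ENat.natCast_lt_top C))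
  calc graphLaplacian Γ f o ≤ ∑ x ∈ B, graphLaplacian Γ f x :=
        Finset.single_le_sum (fun x _ => hsub x) (hFB (Finset.mem_insert_self ..))
    _ = ∑ p ∈ hB.toFinset, (f p.2 - f p.1) := sum_graphLaplacian B hB f
    _ ≤ C * ε := sum_outArcs_le hB hBC hε.le fun p ⟨_, hpB, hadj⟩ => by
        by_contra! hlt
        exact hpB (hFB (Finset.mem_insert_of_mem
          (Finset.mem_image_of_mem _ (hsteep.mem_toFinset.2 ⟨hadj, hlt⟩))))

variable [MeasurableSpace W] [DiscreteMeasurableSpace W]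

lemma graphLaplacian_indicator_avoidProb [Γ.LocallyFinite] (o x : W) :
    graphLaplacian Γ (({o}ᶜ : Set W).indicator fun z => (avoidProb Γ o z).toReal) x =
      Γ.degree x * ({o} : Set W).indicator (fun z => (avoidProb Γ o z).toReal) x := by
  have hfinite : ∀ z, ({o}ᶜ : Set W).indicator (avoidProb Γ o) z ≠ ∞ := fun z =>
    (((Set.indicator_le_self _ _ z).trans (avoidProb_le_one Γ o z)).trans_lt
      ENNReal.one_lt_top).ne
  have htoReal : ∀ z, ({o}ᶜ : Set W).indicator (fun z => (avoidProb Γ o z).toReal) z =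
      (({o}ᶜ : Set W).indicator (avoidProb Γ o) z).toReal := fun z => by
    by_cases hz : z = o <;> simp [hz]
  have hmean : Γ.degree x * (avoidProb Γ o x).toReal = ∑ z ∈ Γ.neighborFinset x,
      ({o}ᶜ : Set W).indicator (fun z => (avoidProb Γ o z).toReal) z := by
    simp only [htoReal]
    rw [← ENNReal.toReal_sum fun z _ => hfinite z, ← degree_mul_lintegral_stepKernel,
      ENNReal.toReal_mul, ENNReal.toReal_natCast]
    exact congrArg (fun v => _ * ENNReal.toReal (v x)) (killedStep_avoidProb Γ o).symm
  rw [graphLaplacian, Finset.sum_sub_distrib, ← hmean, Finset.sum_const,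
    SimpleGraph.card_neighborFinset_eq_degree, nsmul_eq_mul, ← mul_sub, Set.indicator_compl,
    Pi.sub_apply, sub_sub_cancel]

theorem HasSmallCuts.clusterRecurrent (h : HasSmallCuts Γ C) (o : W) : Γ.ClusterRecurrent o := by
  refine ⟨fun y _ => h.finite_neighborSet y, ae_walkLaw_return_of_avoidProb_eq_zero Γ ?_⟩
  by_cases hne : (Γ.neighborSet o).Nonempty
  swap
  · exact avoidProb_self_eq_zero_of_isolated Γ hne
  have : Γ.LocallyFinite := fun x => (h.finite_neighborSet x).fintype
  let v : W → ℝ := fun x => (avoidProb Γ o x).toReal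
  have hv : ∀ x, v x ∈ Set.Icc 0 1 := fun x =>
    ⟨ENNReal.toReal_nonneg, ENNReal.toReal_le_of_le_ofReal zero_le_one
      (ENNReal.ofReal_one.symm ▸ avoidProb_le_one Γ o x)⟩
  have hharm := h.graphLaplacian_eq_zero (f := ({o}ᶜ : Set W).indicator v) (M := 1)
    (fun x => ⟨Set.indicator_nonneg (fun z _ => (hv z).1) x,
      (Set.indicator_le_self' (fun z _ => (hv z).1) x).trans (hv x).2⟩)
    (fun x => by
      rw [graphLaplacian_indicator_avoidProb]
      exact mul_nonneg (Nat.cast_nonneg _) (Set.indicator_nonneg (fun z _ => (hv z).1) x)) o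
  rw [graphLaplacian_indicator_avoidProb, Set.indicator_of_mem (Set.mem_singleton o),
    mul_eq_zero, Nat.cast_eq_zero] at hharm
  have hdeg : Γ.degree o ≠ 0 := ((Γ.degree_pos_iff_exists_adj o).2 hne).ne'
  exact ((ENNReal.toReal_eq_zero_iff _).1 (hharm.resolve_left hdeg)).resolve_right
    ((avoidProb_le_one Γ o o).trans_lt ENNReal.one_lt_top).ne

end SmallCuts

/-! ### Crossings of geometric graphs -/

namespace GeometricGraph

/-- The oriented edges of `g` passing above `t+` from left to right. -/
def arcsAcross (g : GeometricGraph) (t : ℝ) : Set (ℝ × ℝ) :=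
  {p | p.1 ≤ t ∧ t < p.2 ∧ g.graph.Adj p.1 p.2}

/-- The number of edges of `g` above `t+`. -/
noncomputable def crossingsAt (g : GeometricGraph) (t : ℝ) : ℕ∞ := (g.arcsAcross t).encard

lemma crossingsAt_zero (g : GeometricGraph) : g.crossingsAt 0 = g.crossings := rfl

lemma measurable_crossingsAt (t : ℝ) : Measurable fun g : GeometricGraph => g.crossingsAt t := by
  have hquadrant : MeasurableSet {p : ℝ × ℝ | p.1 ≤ t ∧ t < p.2} :=
    (measurableSet_le measurable_fst measurable_const).inter
      (measurableSet_lt measurable_const measurable_snd)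
  have heq : ∀ g : GeometricGraph, g.arcs ∩ {p | p.1 ≤ t ∧ t < p.2} = g.arcsAcross t := fun g => by
    ext p
    exact and_comm.trans and_assoc
  simp only [crossingsAt, ← heq]
  exact measurable_iff_comap_le.2 (le_sup_of_le_right (le_iSup₂_of_le _ hquadrant le_rfl))

lemma measurable_encard_verts_inter {A : Set ℝ} (hA : MeasurableSet A) :
    Measurable fun g : GeometricGraph => (g.verts ∩ A).encard :=
  measurable_iff_comap_le.2 (le_sup_of_le_left (le_iSup₂_of_le A hA le_rfl))

lemma locallyFiniteVerts_iff_nat (g : GeometricGraph) :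
    g.LocallyFiniteVerts ↔ ∀ n : ℕ, (g.verts ∩ Set.Icc (-n : ℝ) n).encard < ⊤ := by
  simp only [Set.encard_lt_top_iff]
  refine ⟨fun h n => h _ _, fun h a b => ?_⟩
  obtain ⟨n, hn⟩ := exists_nat_gt (max |a| |b|)
  refine (h n).subset (Set.inter_subset_inter_right _ (Set.Icc_subset_Icc ?_ ?_))
  · linarith [neg_abs_le a, le_max_left |a| |b|]
  · linarith [le_abs_self b, le_max_right |a| |b|]

lemma measurableSet_locallyFiniteVerts :
    MeasurableSet {g : GeometricGraph | g.LocallyFiniteVerts} := by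
  simp only [locallyFiniteVerts_iff_nat, Set.ofPred_forall]
  exact MeasurableSet.iInter fun n =>
    measurable_encard_verts_inter measurableSet_Icc (.of_discrete (s := Set.Iio ⊤))

lemma LocallyFiniteVerts.eventually_crossingsAt_eq {g : GeometricGraph}
    (hg : g.LocallyFiniteVerts) (t : ℝ) : ∀ᶠ s in 𝓝[>] t, g.crossingsAt s = g.crossingsAt t := by
  have hfin : (g.verts ∩ Set.Ioc t (t + 1)).Finite :=
    (hg t (t + 1)).subset (Set.inter_subset_inter_right _ Set.Ioc_subset_Icc_self)
  have hgap : ∀ᶠ s in 𝓝[>] t, ∀ v ∈ g.verts ∩ Set.Ioc t (t + 1), s < v :=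
    (eventually_all_finite hfin).2 fun v hv => eventually_nhdsWithin_of_eventually_nhds
      (eventually_lt_nhds hv.2.1)
  filter_upwards [hgap, Ioo_mem_nhdsGT (lt_add_one t)] with s hgap hs
  have hside : ∀ v ∈ g.verts, v ≤ s ↔ v ≤ t := fun v hv =>
    ⟨fun hvs => not_lt.1 fun htv => (hgap v ⟨hv, htv, hvs.trans hs.2.le⟩).not_ge hvs,
      fun hvt => hvt.trans hs.1.le⟩
  suffices g.arcsAcross s = g.arcsAcross t from congrArg Set.encard this
  ext ⟨x, y⟩
  simp only [arcsAcross, Set.mem_ofPred_eq, ← and_assoc, and_congr_left_iff]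
  intro hxy
  rw [← not_le, ← not_le, hside x (g.mem_of_adj x y hxy), hside y (g.mem_of_adj y x hxy.symm)]

lemma LocallyFiniteVerts.exists_rat_crossingsAt_eq {g : GeometricGraph}
    (hg : g.LocallyFiniteVerts) (t : ℝ) : ∃ q : ℚ, g.crossingsAt q = g.crossingsAt t := by
  obtain ⟨u, htu, hu⟩ := mem_nhdsGT_iff_exists_Ioo_subset.1 (hg.eventually_crossingsAt_eq t)
  obtain ⟨q, hq⟩ := exists_rat_btwn (Set.mem_Ioi.1 htu)
  exact ⟨q, hu hq⟩

lemma crossingsAt_translate (h : ℝ) (g : GeometricGraph) (t : ℝ) :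
    (translate h g).crossingsAt t = g.crossingsAt (t - h) := by
  have hpreimage : (translate h g).arcsAcross t =
      ((Equiv.subRight h).prodCongr (Equiv.subRight h)) ⁻¹' g.arcsAcross (t - h) := by
    ext p
    simp [arcsAcross, translate]
  rw [crossingsAt, crossingsAt, hpreimage, ← Equiv.image_symm_eq_preimage,
    (Equiv.injective _).encard_image]

lemma crossingsAt_iterate_translate (h : ℝ) (n : ℕ) (g : GeometricGraph) (t : ℝ) :
    ((translate h)^[n] g).crossingsAt t = g.crossingsAt (t - n * h) := by
  induction n generalizing t with
  | zero => simp
  | succ n ih =>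
    rw [Function.iterate_succ_apply', crossingsAt_translate, ih]
    congr 1
    push_cast
    ring

lemma locallyFiniteVerts_translate_iff (h : ℝ) (g : GeometricGraph) :
    (translate h g).LocallyFiniteVerts ↔ g.LocallyFiniteVerts := by
  have hpreimage : ∀ a b, (translate h g).verts ∩ Set.Icc a b =
      Equiv.subRight h ⁻¹' (g.verts ∩ Set.Icc (a - h) (b - h)) := fun a b => by
    ext x
    simp [translate]
  simp only [LocallyFiniteVerts, hpreimage, ← Equiv.image_symm_eq_preimage,
    Set.finite_image_iff (Equiv.injective _).injOn]
  exact ⟨fun H a b => by simpa using H (a + h) (b + h), fun H a b => H _ _⟩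

lemma encard_outArcs_induce_Ioc_le (g : GeometricGraph) (s t : ℝ) :
    (outArcs (g.graph.induce g.verts) (Subtype.val ⁻¹' Set.Ioc s t)).encard ≤
      g.crossingsAt s + g.crossingsAt t := by
  have hinj : Function.Injective (Prod.map Subtype.val Subtype.val : g.verts × g.verts → ℝ × ℝ) :=
    Subtype.val_injective.prodMap Subtype.val_injective
  have hsub : Prod.map Subtype.val Subtype.val ''
      outArcs (g.graph.induce g.verts) (Subtype.val ⁻¹' Set.Ioc s t) ⊆
        Prod.swap '' g.arcsAcross s ∪ g.arcsAcross t := by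
    rintro _ ⟨⟨x, y⟩, ⟨hx, hy, hxy⟩, rfl⟩
    have hadj : g.graph.Adj x y := hxy
    rcases le_or_gt (y : ℝ) s with hys | hsy
    · exact Or.inl ⟨(y, x), ⟨hys, hx.1, hadj.symm⟩, rfl⟩
    · exact Or.inr ⟨hx.2, not_le.1 fun hyt => hy ⟨hsy, hyt⟩, hadj⟩
  rw [← hinj.encard_image, crossingsAt, ← Prod.swap_injective.encard_image (g.arcsAcross s)]
  exact (Set.encard_le_encard hsub).trans (Set.encard_union_le _ _)

lemma LocallyFiniteVerts.hasSmallCuts_induce {g : GeometricGraph} (hg : g.LocallyFiniteVerts)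
    {M N : ℕ} (hbot : ∃ᶠ s in atBot, g.crossingsAt s ≤ M)
    (htop : ∃ᶠ t in atTop, g.crossingsAt t ≤ N) :
    HasSmallCuts (g.graph.induce g.verts) (M + N) := by
  intro F
  obtain ⟨s, hsM, hsF⟩ := (hbot.and_eventually <| (eventually_all_finset F).2 fun x _ =>
    eventually_lt_atBot (x : ℝ)).exists
  obtain ⟨t, htN, htF⟩ := (htop.and_eventually <| (eventually_all_finset F).2 fun x _ =>
    eventually_ge_atTop (x : ℝ)).exists
  have hfin : (Subtype.val ⁻¹' Set.Ioc s t : Set g.verts).Finite := by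
    refine Set.Finite.of_finite_image ((hg s t).subset ?_) Subtype.val_injective.injOn
    rintro _ ⟨x, hx, rfl⟩
    exact ⟨x.2, Set.Ioc_subset_Icc_self hx⟩
  refine ⟨hfin.toFinset, fun x hx => hfin.mem_toFinset.2 ⟨hsF x hx, htF x hx⟩, ?_⟩
  rw [hfin.coe_toFinset, Nat.cast_add]
  exact (g.encard_outArcs_induce_Ioc_le s t).trans (add_le_add hsM htN)

variable {ν : Measure GeometricGraph} {H : AddSubgroup ℝ}

lemma ae_frequently_crossingsAt_sub_le [IsFiniteMeasure ν] {h : ℝ}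
    (hh : MeasurePreserving (translate h) ν ν) (t : ℝ) (M : ℕ∞) :
    ∀ᵐ g ∂ν, g.crossingsAt t ≤ M →
      ∃ᶠ n : ℕ in atTop, g.crossingsAt (t - n * h) ≤ M := by
  have hmeas : MeasurableSet {g : GeometricGraph | g.crossingsAt t ≤ M} :=
    measurable_crossingsAt t (.of_discrete (s := Set.Iic M))
  filter_upwards [hh.conservative.ae_mem_imp_frequently_image_mem hmeas.nullMeasurableSet]
    with g hreturn hgM
  refine (hreturn hgM).mono fun n hn => ?_
  rwa [crossingsAt_iterate_translate] at hn

lemma TranslationInvariant.ae_frequently_crossingsAt_le [IsFiniteMeasure ν]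
    (hinv : TranslationInvariant H ν) (hH : H ≠ ⊥) (t : ℝ) (M : ℕ∞) :
    ∀ᵐ g ∂ν, g.crossingsAt t ≤ M →
      (∃ᶠ s in atBot, g.crossingsAt s ≤ M) ∧ ∃ᶠ s in atTop, g.crossingsAt s ≤ M := by
  obtain ⟨h, hhH, hpos⟩ : ∃ h ∈ H, 0 < h := by
    obtain ⟨h, hhH, hne⟩ := H.bot_or_exists_ne_zero.resolve_left hH
    exact ⟨|h|, abs_mem_iff.2 hhH, abs_pos.2 hne⟩
  have hright : Tendsto (fun n : ℕ => n * h) atTop atTop :=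
    tendsto_natCast_atTop_atTop.atTop_mul_const hpos
  filter_upwards [ae_frequently_crossingsAt_sub_le (hinv h hhH) t M,
    ae_frequently_crossingsAt_sub_le (hinv (-h) (H.neg_mem hhH)) t M] with g hleft' hright' hgM
  refine ⟨Tendsto.frequently ?_ (hleft' hgM), Tendsto.frequently ?_ (hright' hgM)⟩
  · simpa only [sub_eq_add_neg, Function.comp_def] using
      tendsto_atBot_add_const_left _ t (tendsto_neg_atTop_atBot.comp hright)
  · simpa only [mul_neg, sub_neg_eq_add] using tendsto_atTop_add_const_left _ t hright

lemma measurableSet_locallyFiniteVerts_and_exists_crossingsAt_lt_top :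
    MeasurableSet {g : GeometricGraph | g.LocallyFiniteVerts ∧ ∃ t, g.crossingsAt t < ⊤} := by
  have hrat : {g : GeometricGraph | g.LocallyFiniteVerts ∧ ∃ t, g.crossingsAt t < ⊤} =
      {g | g.LocallyFiniteVerts} ∩ ⋃ q : ℚ, {g | g.crossingsAt q < ⊤} := by
    ext g
    simp only [Set.mem_ofPred_eq, Set.mem_inter_iff, Set.mem_iUnion, and_congr_right_iff]
    refine fun hg => ⟨fun ⟨t, ht⟩ => ?_, fun ⟨q, hq⟩ => ⟨q, hq⟩⟩
    obtain ⟨q, hq⟩ := hg.exists_rat_crossingsAt_eq t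
    exact ⟨q, hq ▸ ht⟩
  rw [hrat]
  exact measurableSet_locallyFiniteVerts.inter <| MeasurableSet.iUnion fun q =>
    measurable_crossingsAt q (.of_discrete (s := Set.Iio ⊤))

lemma TranslationErgodic.ae_exists_crossingsAt_lt_top [IsProbabilityMeasure ν]
    (herg : TranslationErgodic H ν) (hfin : ∀ᵐ g ∂ν, g.LocallyFiniteVerts)
    (hX : 0 < ν {g | g.crossings < ⊤}) : ∀ᵐ g ∂ν, ∃ t, g.crossingsAt t < ⊤ := by
  have hmeas := measurableSet_locallyFiniteVerts_and_exists_crossingsAt_lt_top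
  have hpos : 0 < ν {g | g.LocallyFiniteVerts ∧ ∃ t, g.crossingsAt t < ⊤} :=
    hX.trans_le <| measure_mono_ae <| by
      filter_upwards [hfin] with g hg hgX
      exact ⟨hg, 0, g.crossingsAt_zero.trans_lt hgX⟩
  have hone := (herg _ hmeas fun h _ => by
    ext g
    have hshift : (∃ t, g.crossingsAt (t - h) < ⊤) ↔ ∃ t, g.crossingsAt t < ⊤ :=
      ((Equiv.subRight h).surjective.exists (p := fun t => g.crossingsAt t < ⊤)).symm
    simp only [Set.preimage_ofPred_eq, Set.mem_ofPred_eq, locallyFiniteVerts_translate_iff,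
      crossingsAt_translate, hshift]).resolve_left hpos.ne'
  filter_upwards [(prob_compl_eq_zero_iff hmeas).2 hone] with g hg using hg.2

end GeometricGraph

theorem mainTheorem2_general {Ω : Type*} [MeasurableSpace Ω] (P : Measure Ω) [IsFiniteMeasure P]
    (G : Ω → GeometricGraph) (hG : Measurable G)
    (hfin : ∀ᵐ ω ∂P, (G ω).LocallyFiniteVerts)
    (H : AddSubgroup ℝ) (hH : H ≠ ⊥)
    (hinv : GeometricGraph.TranslationInvariant H (P.map G)) :
    ∀ᵐ ω ∂P, (∃ t, (G ω).crossingsAt t < ⊤) → (G ω).AllClustersRecurrent := by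
  have hfreq : ∀ᵐ g : GeometricGraph ∂(P.map G), ∀ (q : ℚ) (M : ℕ), g.crossingsAt q ≤ M →
      (∃ᶠ s in atBot, g.crossingsAt s ≤ M) ∧ ∃ᶠ s in atTop, g.crossingsAt s ≤ M :=
    ae_all_iff.2 fun q => ae_all_iff.2 fun M => hinv.ae_frequently_crossingsAt_le hH q M
  filter_upwards [hfin, ae_of_ae_map hG.aemeasurable hfreq] with ω hlf hfreq ⟨t, ht⟩ x
  obtain ⟨q, hq⟩ := hlf.exists_rat_crossingsAt_eq t
  obtain ⟨M, hM⟩ := ENat.ne_top_iff_exists.1 (hq.trans_lt ht).ne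
  obtain ⟨hbot, htop⟩ := hfreq q M hM.ge
  exact (hlf.hasSmallCuts_induce hbot htop).clusterRecurrent x

theorem mainTheorem2 {Ω : Type*} [MeasurableSpace Ω] (P : Measure Ω) [IsProbabilityMeasure P]
    (G : Ω → GeometricGraph) (hG : Measurable G)
    (hfin : ∀ᵐ ω ∂P, (G ω).LocallyFiniteVerts)
    (H : AddSubgroup ℝ) (hH : H ≠ ⊥)
    (hinv : GeometricGraph.TranslationInvariant H (P.map G))
    (herg : GeometricGraph.TranslationErgodic H (P.map G))
    (hX : 0 < P {ω | (G ω).crossings < ⊤}) :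
    ∀ᵐ ω ∂P, (G ω).AllClustersRecurrent := by
  have : IsProbabilityMeasure (P.map G) := Measure.isProbabilityMeasure_map hG.aemeasurable
  have hlf : ∀ᵐ g ∂(P.map G), g.LocallyFiniteVerts :=
    (ae_map_iff hG.aemeasurable GeometricGraph.measurableSet_locallyFiniteVerts).2 hfin
  have hcut : ∀ᵐ g ∂(P.map G), ∃ t, g.crossingsAt t < ⊤ :=
    herg.ae_exists_crossingsAt_lt_top hlf (hX.trans_le (Measure.le_map_apply hG.aemeasurable _))
  filter_upwards [mainTheorem2_general P G hG hfin H hH hinv, ae_of_ae_map hG.aemeasurable hcut]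
    with ω hrec hcut using hrec hcut
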